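/- Let $R_0>0$ and let $f,g$ be real functions on $(-R_0,R_0)$ that are even, vanish at $0$ and are positive on $(0,R_0)$. Put $F=-\ln f$ and $G=-\ln g$ on $(0,R_0)$, and assume that $F$ and $G$ tend to $+\infty$ at $0^+$ and are twice differentiable on $(0,R_0)$ with $F'<0$, $F''>0$, $G'<0$, $G''>0$. For a matrix function $A$ (with values in the symmetric nonnegative definite $n\times n$ matrices), a Lipschitz curve $\gamma:[0,r]\to\mathbb R^n$ is called subunit if for almost every $t\in[0,r]$ one has $(\xi\cdot\gamma'(t))^2\le \xi^{T}A(\gamma(t))\,\xi$ for all $\xi\in\mathbb R^n$; the Carnot–Carathéodory distance $d_A(p,q)$ is the infimum of all $r>0$ for which some subunit curve $\gamma:[0,r]\to\mathbb R^n$ joins $p$ to $q$ ($+\infty$ if there is none). Let $B(0,R)$ be the open ball of radius $R$ about the origin of $\mathbb R^3$ for $A(x)=\mathrm{diag}\{1,f^2(x_1),g^2(x_1)\}$, and let $B^{f}_{2D}(0,R)$ and $B^{g}_{2D}(0,R)$ be the open balls of radius $R$ about the origin of $\mathbb R^2$ for $\mathrm{diag}\{1,f^2(x_1)\}$ and $\mathrm{diag}\{1,g^2(x_1)\}$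 respectively. (For $0<R<R_0$ only curves with $|x_1|<R_0$ enter.) Then for every $0<R<R_0$ the projection of $B(0,R)$ onto the $xy$-plane is contained in $B^{f}_{2D}(0,R)$, the projection of $B(0,R)$ onto the $xz$-plane is contained in $B^{g}_{2D}(0,R)$, and $$|B(0,R)|\le C\,\min\left\{\frac{f(R)\,g(R)}{|F'(R)|^2\,|G'(R)|},\ \frac{f(R)\,g(R)}{|F'(R)|\,|G'(R)|^2}\right\},$$ where $|\cdot|$ of a set is Lebesgue measure and $C>0$ is an absolute constant, independent of $f$, $g$, $R_0$ and $R$. -/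

import Mathlib

open MeasureTheory Set Filter Topology
open scoped ENNReal NNReal Matrix

namespace CarnotCaratheodory

/-- `γ : [0, r] → ℝⁿ` is a subunit curve for the matrix function `A`: it is Lipschitz and
`(ξ · γ'(t))² ≤ ξᵀ A(γ(t)) ξ` for almost every `t ∈ [0, r]` and every `ξ ∈ ℝⁿ`.
(Being Lipschitz does not depend on the norm chosen on `ℝⁿ`.) -/
def IsSubunit {n : ℕ} (A : (Fin n → ℝ) → Matrix (Fin n) (Fin n) ℝ) (r : ℝ)
    (γ : ℝ → Fin n → ℝ) : Prop :=
  (∃ K : ℝ≥0, LipschitzOnWith K γ (Icc 0 r)) ∧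
    ∀ᵐ t ∂(volume.restrict (Icc 0 r)), DifferentiableAt ℝ γ t ∧
      ∀ ξ : Fin n → ℝ, (ξ ⬝ᵥ deriv γ t) ^ 2 ≤ ξ ⬝ᵥ (A (γ t) *ᵥ ξ)

/-- The Carnot–Carathéodory (subunit) distance of `A`: the infimum of all `r > 0` such that some
subunit curve `γ : [0, r] → ℝⁿ` joins `p` to `q` (and `∞` if there is none). -/
noncomputable def ccDist {n : ℕ} (A : (Fin n → ℝ) → Matrix (Fin n) (Fin n) ℝ)
    (p q : Fin n → ℝ) : ℝ≥0∞ :=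
  sInf {d : ℝ≥0∞ | ∃ r : ℝ, 0 < r ∧ d = ENNReal.ofReal r ∧
    ∃ γ : ℝ → Fin n → ℝ, IsSubunit A r γ ∧ γ 0 = p ∧ γ r = q}

/-- The open ball `B(p, R)` of the Carnot–Carathéodory distance of `A`. -/
def ccBall {n : ℕ} (A : (Fin n → ℝ) → Matrix (Fin n) (Fin n) ℝ)
    (p : Fin n → ℝ) (R : ℝ) : Set (Fin n → ℝ) :=
  {q | ccDist A p q < ENNReal.ofReal R}

/-- The matrix function `diag{1, f²(x₁)}` on `ℝ²`. -/
def diag2 (f : ℝ → ℝ) (p : Fin 2 → ℝ) : Matrix (Fin 2) (Fin 2) ℝ :=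
  Matrix.diagonal ![1, f (p 0) ^ 2]

/-- The matrix function `diag{1, f²(x₁), g²(x₁)}` on `ℝ³`. -/
def diag3 (f g : ℝ → ℝ) (p : Fin 3 → ℝ) : Matrix (Fin 3) (Fin 3) ℝ :=
  Matrix.diagonal ![1, f (p 0) ^ 2, g (p 0) ^ 2]

/-- The function `F = - ln f`, so that `f = e^{-F}` where `f > 0`. -/
noncomputable def negLog (f : ℝ → ℝ) (x : ℝ) : ℝ := -Real.log (f x)

/-- `f = e^{-F}` is a degenerate profile on `(-R₀, R₀)`: it is even, vanishes at `0` and is positive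
on `(0, R₀)`, where `F = - ln f` is twice differentiable with `F' < 0` and `F'' > 0`, and
`F(x) → +∞` as `x → 0⁺`. -/
structure IsDegenerateProfile (f : ℝ → ℝ) (R₀ : ℝ) : Prop where
  map_zero : f 0 = 0
  even : ∀ x ∈ Ioo 0 R₀, f (-x) = f x
  pos : ∀ x ∈ Ioo 0 R₀, 0 < f x
  tendsto : Tendsto (negLog f) (𝓝[>] 0) atTop
  differentiableAt : ∀ x ∈ Ioo 0 R₀, DifferentiableAt ℝ (negLog f) x
  differentiableAt_deriv : ∀ x ∈ Ioo 0 R₀, DifferentiableAt ℝ (deriv (negLog f)) x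
  deriv_neg : ∀ x ∈ Ioo 0 R₀, deriv (negLog f) x < 0
  deriv_deriv_pos : ∀ x ∈ Ioo 0 R₀, 0 < deriv (deriv (negLog f)) x

end CarnotCaratheodory

namespace CarnotCaratheodory

/-! Dropping a coordinate keeps a curve subunit on the same time interval, so the ball projects into
the two plane balls. Write `x` for the first coordinate. Convexity puts `F` above its tangent at
`R`, that is, `f u ≤ f R * exp (-a (R - u))` with `a = |F' R|` (`IsDegenerateProfile.abs_le_exp`). A
curve of duration `r < R` from the origin to a point with first coordinate `x` satisfies `|x₁(t)| ≤
min t (|x| + r - t) ≤ (|x| + r) / 2`. Integrating the exponential along the curve gives `|y| ≤ 2 (f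
R / a) exp (-a (R - |x|) / 2)` (`IsDegenerateProfile.abs_le_of_mem_ccBall`), and likewise for `z`
with `g` and `b = |G' R|`. The slices of the ball at fixed `x` thus lie in rectangles. Keeping the
decay in one side only and integrating over `x` gains a factor `4 / a` or `4 / b`, which yields the
two terms of the minimum. -/

/-! ### Subunit curves and their projections -/

/-- A Lipschitz function whose derivative is dominated by an integrable function `ψ` varies by at
most the integral of `ψ`. -/
theorem abs_sub_le_integral_of_abs_deriv_le {u ψ : ℝ → ℝ} {a b : ℝ} {K : ℝ≥0} (hab : a ≤ b)
    (hu : LipschitzOnWith K u (Icc a b)) (hψ : IntervalIntegrable ψ volume a b)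
    (h : ∀ᵐ t ∂volume.restrict (Icc a b), |deriv u t| ≤ ψ t) :
    |u b - u a| ≤ ∫ t in a..b, ψ t := by
  rw [← uIcc_of_le hab] at hu
  -- A Lipschitz function is absolutely continuous, hence the integral of its a.e. derivative.
  rw [← hu.absolutelyContinuousOnInterval.integral_deriv_eq_sub, ← Real.norm_eq_abs]
  refine intervalIntegral.norm_integral_le_of_norm_le hab ?_ hψ
  filter_upwards [(ae_restrict_iff' measurableSet_Icc).1 h] with t ht hm
  exact ht (Ioc_subset_Icc_self hm)

theorem lipschitzOnWith_comp_index {m n : ℕ} (σ : Fin m → Fin n) {K : ℝ≥0} {γ : ℝ → Fin n → ℝ}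
    {s : Set ℝ} (h : LipschitzOnWith K γ s) : LipschitzOnWith K (fun t => γ t ∘ σ) s := by
  refine LipschitzOnWith.of_dist_le_mul fun x hx y hy => ?_
  refine (dist_pi_le_iff (by positivity)).2 fun i => ?_
  exact (dist_le_pi_dist (γ x) (γ y) (σ i)).trans (h.dist_le_mul x hx y hy)

/-- A coordinate projection maps subunit curves to subunit curves as soon as it transforms the
quadratic forms into each other. -/
theorem IsSubunit.comp_index {m n : ℕ} {A : (Fin n → ℝ) → Matrix (Fin n) (Fin n) ℝ}
    {A' : (Fin m → ℝ) → Matrix (Fin m) (Fin m) ℝ} {r : ℝ} {γ : ℝ → Fin n → ℝ}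
    (h : IsSubunit A r γ) (σ : Fin m → Fin n)
    (hσ : ∀ ξ : Fin m → ℝ, ∃ η : Fin n → ℝ, (∀ v : Fin n → ℝ, ξ ⬝ᵥ (v ∘ σ) = η ⬝ᵥ v) ∧
      ∀ p, η ⬝ᵥ (A p *ᵥ η) = ξ ⬝ᵥ (A' (p ∘ σ) *ᵥ ξ)) :
    IsSubunit A' r (fun t => γ t ∘ σ) := by
  obtain ⟨⟨K, hK⟩, hd⟩ := h
  refine ⟨⟨K, lipschitzOnWith_comp_index σ hK⟩, ?_⟩
  filter_upwards [hd] with t ht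
  have hder : HasDerivAt (fun t => γ t ∘ σ) (deriv γ t ∘ σ) t :=
    hasDerivAt_pi.2 fun i => hasDerivAt_pi.1 ht.1.hasDerivAt (σ i)
  refine ⟨hder.differentiableAt, fun ξ => ?_⟩
  obtain ⟨η, h1, h2⟩ := hσ ξ
  rw [hder.deriv, h1, ← h2]
  exact ht.2 η

theorem mem_ccBall_iff {n : ℕ} {A : (Fin n → ℝ) → Matrix (Fin n) (Fin n) ℝ} {p q : Fin n → ℝ}
    {R : ℝ} : q ∈ ccBall A p R ↔ ∃ r : ℝ, 0 < r ∧ r < R ∧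
      ∃ γ : ℝ → Fin n → ℝ, IsSubunit A r γ ∧ γ 0 = p ∧ γ r = q := by
  simp only [ccBall, ccDist, mem_ofPred_eq, sInf_lt_iff]
  constructor
  · rintro ⟨_, ⟨r, hr, rfl, hγ⟩, hlt⟩
    exact ⟨r, hr, (ENNReal.ofReal_lt_ofReal_iff_of_nonneg hr.le).1 hlt, hγ⟩
  · rintro ⟨r, hr, hrR, hγ⟩
    exact ⟨_, ⟨r, hr, rfl, hγ⟩, (ENNReal.ofReal_lt_ofReal_iff_of_nonneg hr.le).2 hrR⟩

/-- The projected curve has the same parameter interval, so the radius is unchanged. -/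
theorem image_ccBall_subset {m n : ℕ} {A : (Fin n → ℝ) → Matrix (Fin n) (Fin n) ℝ}
    {A' : (Fin m → ℝ) → Matrix (Fin m) (Fin m) ℝ} (σ : Fin m → Fin n)
    (hσ : ∀ ξ : Fin m → ℝ, ∃ η : Fin n → ℝ, (∀ v : Fin n → ℝ, ξ ⬝ᵥ (v ∘ σ) = η ⬝ᵥ v) ∧
      ∀ p, η ⬝ᵥ (A p *ᵥ η) = ξ ⬝ᵥ (A' (p ∘ σ) *ᵥ ξ)) (p : Fin n → ℝ) (R : ℝ) :
    (fun q : Fin n → ℝ => q ∘ σ) '' ccBall A p R ⊆ ccBall A' (p ∘ σ) R := by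
  rintro _ ⟨q, hq, rfl⟩
  obtain ⟨r, hr, hrR, γ, hγ, rfl, rfl⟩ := mem_ccBall_iff.1 hq
  exact mem_ccBall_iff.2 ⟨r, hr, hrR, _, hγ.comp_index σ hσ, rfl, rfl⟩

theorem image_ccBall_diag3_subset_fst (f g : ℝ → ℝ) (R : ℝ) :
    (fun p : Fin 3 → ℝ => ![p 0, p 1]) '' ccBall (diag3 f g) 0 R ⊆ ccBall (diag2 f) 0 R := by
  have h := image_ccBall_subset (A := diag3 f g) (A' := diag2 f) ![0, 1] (fun ξ =>
    -- The covector is extended by zero in the forgotten coordinate; `f` depends only on `p 0`,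
    -- which is kept.
    ⟨![ξ 0, ξ 1, 0], fun v => by simp [dotProduct, Fin.sum_univ_succ], fun p => by
      simp [diag2, diag3, dotProduct, Matrix.mulVec_diagonal, Fin.sum_univ_succ]⟩) 0 R
  convert h using 3 with p
  · ext i; fin_cases i <;> rfl
  · rfl

theorem image_ccBall_diag3_subset_snd (f g : ℝ → ℝ) (R : ℝ) :
    (fun p : Fin 3 → ℝ => ![p 0, p 2]) '' ccBall (diag3 f g) 0 R ⊆ ccBall (diag2 g) 0 R := by
  have h := image_ccBall_subset (A := diag3 f g) (A' := diag2 g) ![0, 2] (fun ξ =>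
    ⟨![ξ 0, 0, ξ 1], fun v => by simp [dotProduct, Fin.sum_univ_succ], fun p => by
      simp [diag2, diag3, dotProduct, Matrix.mulVec_diagonal, Fin.sum_univ_succ]⟩) 0 R
  convert h using 3 with p
  · ext i; fin_cases i <;> rfl
  · rfl

/-! ### Exponential bounds from convexity -/

/-- The tangent line of `F = - ln f` at `R`, exponentiated. -/
theorem IsDegenerateProfile.abs_le_exp {f : ℝ → ℝ} {R₀ R : ℝ} (hf : IsDegenerateProfile f R₀)
    (hR : 0 < R) (hRR₀ : R < R₀) {x : ℝ} (hx : |x| < R) :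
    |f x| ≤ f R * Real.exp (-(|deriv (negLog f) R| * (R - |x|))) := by
  have hRm : R ∈ Ioo 0 R₀ := ⟨hR, hRR₀⟩
  have hfR := hf.pos R hRm
  have key : ∀ u, 0 < u → u < R →
      f u ≤ f R * Real.exp (-(|deriv (negLog f) R| * (R - u))) := by
    intro u hu huR
    have hsub : Icc u R ⊆ Ioo 0 R₀ := fun t ht => ⟨hu.trans_le ht.1, ht.2.trans_lt hRR₀⟩
    obtain ⟨c, hc, hceq⟩ := exists_deriv_eq_slope (negLog f) huR
      (fun t ht => (hf.differentiableAt t (hsub ht)).continuousAt.continuousWithinAt)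
      (fun t ht => (hf.differentiableAt t (hsub (Ioo_subset_Icc_self ht))).differentiableWithinAt)
    have hmono : StrictMonoOn (deriv (negLog f)) (Ioo 0 R₀) := by
      refine strictMonoOn_of_deriv_pos (convex_Ioo _ _) (fun t ht =>
        (hf.differentiableAt_deriv t ht).continuousAt.continuousWithinAt) fun t ht => ?_
      exact hf.deriv_deriv_pos t (interior_subset ht)
    -- `F'` increases, so the slope of the chord over `[u, R]` is at most `F' R`.
    have hle := (hmono (hsub (Ioo_subset_Icc_self hc)) hRm hc.2).le
    rw [hceq, div_le_iff₀ (sub_pos.2 huR)] at hle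
    have hfu := hf.pos u ⟨hu, huR.trans hRR₀⟩
    rw [abs_of_neg (hf.deriv_neg R hRm), ← Real.log_le_log_iff hfu (by positivity),
      Real.log_mul hfR.ne' (Real.exp_pos _).ne', Real.log_exp]
    simp only [negLog] at hle ⊢
    linarith
  rcases lt_trichotomy x 0 with h | h | h
  · rw [abs_of_neg h] at hx ⊢
    have hm : -x ∈ Ioo 0 R₀ := ⟨neg_pos.2 h, hx.trans hRR₀⟩
    have he := hf.even (-x) hm
    rw [neg_neg] at he
    rw [he, abs_of_pos (hf.pos _ hm)]
    exact key _ hm.1 hx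
  · subst h
    rw [hf.map_zero, abs_zero]
    positivity
  · rw [abs_of_pos h] at hx ⊢
    rw [abs_of_pos (hf.pos x ⟨h, hx.trans hRR₀⟩)]
    exact key x h hx

/-- The antiderivative at the lower endpoint is positive and is discarded, so the length of the
interval does not enter. -/
theorem integral_exp_neg_mul_sub_le {a : ℝ} (ha : 0 < a) (c s t : ℝ) :
    ∫ u in s..t, Real.exp (-(a * (c - u))) ≤ Real.exp (-(a * (c - t))) / a := by
  have hd : ∀ u ∈ uIcc s t, HasDerivAt (fun u => Real.exp (-(a * (c - u))) / a)
      (Real.exp (-(a * (c - u)))) u := by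
    intro u _
    have h := (((((hasDerivAt_id u).const_sub c).const_mul a).neg).exp).div_const a
    refine h.congr_deriv ?_
    rw [show -(a * -1) = a by ring, mul_div_cancel_right₀ _ ha.ne']
    rfl
  rw [intervalIntegral.integral_eq_sub_of_hasDerivAt hd
    (Continuous.intervalIntegrable (by fun_prop) _ _)]
  have : 0 ≤ Real.exp (-(a * (c - s))) / a := by positivity
  linarith

theorem integral_exp_neg_mul_add_le {a : ℝ} (ha : 0 < a) (c s t : ℝ) :
    ∫ u in s..t, Real.exp (-(a * (c + u))) ≤ Real.exp (-(a * (c + s))) / a := by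
  have h := integral_exp_neg_mul_sub_le ha c (-t) (-s)
  rw [← intervalIntegral.integral_comp_neg] at h
  simpa using h

/-! ### Plane balls -/

/-- The components of a curve that is subunit for `diag{1, f²(x₁)}` have slopes at most `1` and
`|f(x₁)|`. -/
theorem IsSubunit.abs_deriv_le {f : ℝ → ℝ} {r : ℝ} {γ : ℝ → Fin 2 → ℝ}
    (h : IsSubunit (diag2 f) r γ) : ∀ᵐ t ∂volume.restrict (Icc 0 r),
      |deriv (fun t => γ t 0) t| ≤ 1 ∧ |deriv (fun t => γ t 1) t| ≤ |f (γ t 0)| := by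
  filter_upwards [h.2] with t ht
  have hd := hasDerivAt_pi.1 ht.1.hasDerivAt
  rw [(hd 0).deriv, (hd 1).deriv]
  constructor
  · have := ht.2 ![1, 0]
    simp [diag2, dotProduct, Matrix.mulVec_diagonal, Fin.sum_univ_succ] at this
    exact this
  · have := ht.2 ![0, 1]
    simp [diag2, dotProduct, Matrix.mulVec_diagonal, Fin.sum_univ_succ] at this
    exact sq_le_sq.1 this

/-- A plane ball is contained in a cusp-shaped region. -/
theorem IsDegenerateProfile.abs_le_of_mem_ccBall {f : ℝ → ℝ} {R₀ R : ℝ}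
    (hf : IsDegenerateProfile f R₀) (hR : 0 < R) (hRR₀ : R < R₀) {q : Fin 2 → ℝ}
    (hq : q ∈ ccBall (diag2 f) 0 R) :
    |q 0| ≤ R ∧ |q 1| ≤ 2 * (f R / |deriv (negLog f) R|) *
      Real.exp (-(|deriv (negLog f) R| / 2 * (R - |q 0|))) := by
  have hRm : R ∈ Ioo 0 R₀ := ⟨hR, hRR₀⟩
  have hfR := hf.pos R hRm
  have ha : 0 < |deriv (negLog f) R| := abs_pos.2 (hf.deriv_neg R hRm).ne
  have hexp := @IsDegenerateProfile.abs_le_exp f R₀ R hf hR hRR₀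
  set a := |deriv (negLog f) R|
  obtain ⟨r, hr, hrR, γ, hγ, h0, rfl⟩ := mem_ccBall_iff.1 hq
  obtain ⟨K, hK⟩ := hγ.1
  have hLip : ∀ i, LipschitzOnWith K (fun t => γ t i) (Icc 0 r) := fun i =>
    LipschitzOnWith.of_dist_le_mul fun x hx y hy =>
      (dist_le_pi_dist (γ x) (γ y) i).trans (hK.dist_le_mul x hx y hy)
  have hder := hγ.abs_deriv_le
  have hx : ∀ s t, 0 ≤ s → s ≤ t → t ≤ r → |γ t 0 - γ s 0| ≤ t - s := by
    intro s t hs hst htr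
    have hsub : Icc s t ⊆ Icc 0 r := Icc_subset_Icc hs htr
    have := abs_sub_le_integral_of_abs_deriv_le (ψ := fun _ => 1) hst ((hLip 0).mono hsub)
      (by simp) ((ae_restrict_of_ae_restrict_of_subset hsub hder).mono fun _ h => h.1)
    simpa using this
  have hx0 : ∀ t, 0 ≤ t → t ≤ r → |γ t 0| ≤ t := by
    intro t ht htr
    simpa [h0] using hx 0 t le_rfl ht htr
  have hxr : ∀ t, 0 ≤ t → t ≤ r → |γ t 0| ≤ |γ r 0| + (r - t) := by
    intro t ht htr
    have h1 := hx t r ht htr le_rfl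
    have h2 := abs_sub_abs_le_abs_sub (γ t 0) (γ r 0)
    rw [abs_sub_comm] at h2
    linarith
  have hq0 := hx0 r hr.le le_rfl
  refine ⟨hq0.trans hrR.le, ?_⟩
  -- The time at which the two bounds `t` and `|γ r 0| + (r - t)` on `|γ t 0|` coincide; each is
  -- used on the side where it is the smaller.
  set τ := (|γ r 0| + r) / 2 with hτ
  have hτ0 : 0 ≤ τ := by positivity
  have hτr : τ ≤ r := by linarith
  have hdom : ∀ s t, 0 ≤ s → s ≤ t → t ≤ r → ∀ ρ : ℝ → ℝ, Continuous ρ →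
      (∀ u ∈ Icc s t, |γ u 0| ≤ ρ u) →
      |γ t 1 - γ s 1| ≤ f R * ∫ u in s..t, Real.exp (-(a * (R - ρ u))) := by
    intro s t hs hst htr ρ hρ hle
    have hsub : Icc s t ⊆ Icc 0 r := Icc_subset_Icc hs htr
    rw [← intervalIntegral.integral_const_mul]
    refine abs_sub_le_integral_of_abs_deriv_le hst ((hLip 1).mono hsub)
      (Continuous.intervalIntegrable (by fun_prop) _ _) ?_
    filter_upwards [ae_restrict_of_ae_restrict_of_subset hsub hder,
      ae_restrict_mem measurableSet_Icc] with u hu hum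
    have hum' := hsub hum
    refine hu.2.trans ((hexp (((hx0 u hum'.1 hum'.2).trans hum'.2).trans_lt hrR)).trans ?_)
    have := hle u hum
    gcongr
  -- Since `r < R`, `R - τ ≥ (R - |γ r 0|) / 2`; this halves the rate `a`.
  have hE : Real.exp (-(a * (R - τ))) ≤ Real.exp (-(a / 2 * (R - |γ r 0|))) := by
    rw [Real.exp_le_exp]
    have : a * (r - R) ≤ 0 := mul_nonpos_of_nonneg_of_nonpos ha.le (by linarith)
    rw [hτ]; linarith
  have h1 : |γ τ 1 - γ 0 1| ≤ f R * (Real.exp (-(a / 2 * (R - |γ r 0|))) / a) := by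
    refine (hdom 0 τ le_rfl hτ0 hτr (fun u => u) continuous_id
      fun u hu => hx0 u hu.1 (hu.2.trans hτr)).trans ?_
    have := integral_exp_neg_mul_sub_le ha R 0 τ
    gcongr
    exact this.trans (by gcongr)
  have h2 : |γ r 1 - γ τ 1| ≤ f R * (Real.exp (-(a / 2 * (R - |γ r 0|))) / a) := by
    refine (hdom τ r hτ0 hτr le_rfl (fun u => |γ r 0| + (r - u)) (by fun_prop)
      fun u hu => hxr u (hτ0.trans hu.1) hu.2).trans ?_
    -- After `τ` the exponential decreases in `u`, so its value at the left endpoint `τ` controls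
    -- the integral.
    have := integral_exp_neg_mul_add_le ha (R - |γ r 0| - r) τ r
    rw [show R - |γ r 0| - r + τ = R - τ by rw [hτ]; ring] at this
    gcongr
    refine le_trans (le_of_eq ?_) (this.trans (by gcongr))
    congr 1; ext u; ring_nf
  have h3 : |γ r 1| ≤ |γ r 1 - γ τ 1| + |γ τ 1 - γ 0 1| := by
    have := abs_sub_le (γ r 1) (γ τ 1) (γ 0 1)
    simpa [h0] using this
  calc |γ r 1| ≤ f R * (Real.exp (-(a / 2 * (R - |γ r 0|))) / a) +
        f R * (Real.exp (-(a / 2 * (R - |γ r 0|))) / a) := by linarith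
    _ = _ := by ring

/-! ### Volume of the ball in space -/

theorem integral_exp_neg_mul_sub_abs_le {b R : ℝ} (hb : 0 < b) (hR : 0 ≤ R) :
    ∫ x in (-R)..R, Real.exp (-(b * (R - |x|))) ≤ 2 / b := by
  calc ∫ x in (-R)..R, Real.exp (-(b * (R - |x|)))
      ≤ ∫ x in (-R)..R, (Real.exp (-(b * (R - x))) + Real.exp (-(b * (R + x)))) := by
        refine intervalIntegral.integral_mono_on (by linarith)
          (Continuous.intervalIntegrable (by fun_prop) _ _)
          (Continuous.intervalIntegrable (by fun_prop) _ _) fun x _ => ?_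
        rcases abs_cases x with ⟨h, _⟩ | ⟨h, _⟩ <;> rw [h]
        · linarith [Real.exp_pos (-(b * (R + x)))]
        · rw [sub_neg_eq_add]
          linarith [Real.exp_pos (-(b * (R - x)))]
    _ ≤ 1 / b + 1 / b := by
        rw [intervalIntegral.integral_add (Continuous.intervalIntegrable (by fun_prop) _ _)
          (Continuous.intervalIntegrable (by fun_prop) _ _)]
        have h1 := integral_exp_neg_mul_sub_le hb R (-R) R
        have h2 := integral_exp_neg_mul_add_le hb R (-R) R
        simp only [sub_self, add_neg_cancel, mul_zero, neg_zero, Real.exp_zero] at h1 h2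
        exact add_le_add h1 h2
    _ = 2 / b := by ring

/-- The volume of a region of `ℝ³` whose slices are rectangles. -/
theorem volume_setOf_abs_le_le {R : ℝ} {h k : ℝ → ℝ} (hR : 0 ≤ R) (hh : Continuous h)
    (hk : Continuous k) (hh0 : ∀ x, 0 ≤ h x) (hk0 : ∀ x, 0 ≤ k x) :
    volume {p : Fin 3 → ℝ | |p 0| ≤ R ∧ |p 1| ≤ h (p 0) ∧ |p 2| ≤ k (p 0)} ≤
      ENNReal.ofReal (∫ x in (-R)..R, 2 * h x * (2 * k x)) := by
  -- The region is closed, so Tonelli applies with the first coordinate split off.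
  set T : Set (ℝ × (Fin 2 → ℝ)) := {q | |q.1| ≤ R ∧ |q.2 0| ≤ h q.1 ∧ |q.2 1| ≤ k q.1} with hT
  have hTm : MeasurableSet T := by
    refine IsClosed.measurableSet ?_
    have h0 : IsClosed {q : ℝ × (Fin 2 → ℝ) | |q.1| ≤ R} := isClosed_le (by fun_prop) (by fun_prop)
    have h1 : IsClosed {q : ℝ × (Fin 2 → ℝ) | |q.2 0| ≤ h q.1} :=
      isClosed_le (by fun_prop) (by fun_prop)
    have h2 : IsClosed {q : ℝ × (Fin 2 → ℝ) | |q.2 1| ≤ k q.1} :=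
      isClosed_le (by fun_prop) (by fun_prop)
    exact h0.inter (h1.inter h2)
  have hmp := volume_preserving_piFinSuccAbove (fun _ : Fin 3 => ℝ) 0
  have hpre : {p : Fin 3 → ℝ | |p 0| ≤ R ∧ |p 1| ≤ h (p 0) ∧ |p 2| ≤ k (p 0)} =
      MeasurableEquiv.piFinSuccAbove (fun _ : Fin 3 => ℝ) 0 ⁻¹' T := by
    ext p; rfl
  rw [hpre, hmp.measure_preimage hTm.nullMeasurableSet, Measure.volume_eq_prod,
    Measure.prod_apply hTm]
  have hslice : ∀ x, volume (Prod.mk x ⁻¹' T) ≤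
      (Icc (-R) R).indicator (fun x => ENNReal.ofReal (2 * h x * (2 * k x))) x := by
    intro x
    by_cases hx : x ∈ Icc (-R) R
    · rw [indicator_of_mem hx]
      refine (measure_mono (t := Icc ![-h x, -k x] ![h x, k x]) ?_).trans ?_
      · rintro w ⟨-, h1, h2⟩
        rw [abs_le] at h1 h2
        refine ⟨fun i => ?_, fun i => ?_⟩ <;> fin_cases i
        exacts [h1.1, h2.1, h1.2, h2.2]
      · rw [Real.volume_Icc_pi]
        simp only [Fin.prod_univ_two, Matrix.cons_val_zero, Matrix.cons_val_one]
        rw [← ENNReal.ofReal_mul (by linarith [hh0 x])]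
        apply le_of_eq; congr 1; ring
    · rw [indicator_of_notMem hx]
      refine le_of_eq ?_
      convert measure_empty (μ := volume)
      ext w
      simp only [hT, mem_preimage, mem_ofPred_eq, mem_empty_iff_false, iff_false]
      exact fun hw => hx (abs_le.1 hw.1)
  refine (lintegral_mono hslice).trans ?_
  rw [lintegral_indicator measurableSet_Icc,
    intervalIntegral.integral_of_le (by linarith), ← integral_Icc_eq_integral_Ioc,
    ofReal_integral_eq_lintegral_ofReal]
  · exact (Continuous.continuousOn (by fun_prop)).integrableOn_Icc
  · exact ae_of_all _ fun x => mul_nonneg (by linarith [hh0 x]) (by linarith [hk0 x])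

theorem volume_ccBall_diag3_le {f g : ℝ → ℝ} {R₀ R : ℝ} (hf : IsDegenerateProfile f R₀)
    (hg : IsDegenerateProfile g R₀) (hR : 0 < R) (hRR₀ : R < R₀) :
    volume (ccBall (diag3 f g) 0 R) ≤ ENNReal.ofReal (64 * min
      (f R * g R / (|deriv (negLog f) R| ^ 2 * |deriv (negLog g) R|))
      (f R * g R / (|deriv (negLog f) R| * |deriv (negLog g) R| ^ 2))) := by
  have hRm : R ∈ Ioo 0 R₀ := ⟨hR, hRR₀⟩
  have hfR := hf.pos R hRm
  have hgR := hg.pos R hRm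
  have hcf := @IsDegenerateProfile.abs_le_of_mem_ccBall f R₀ R hf hR hRR₀
  have hcg := @IsDegenerateProfile.abs_le_of_mem_ccBall g R₀ R hg hR hRR₀
  have ha : 0 < |deriv (negLog f) R| := abs_pos.2 (hf.deriv_neg R hRm).ne
  have hb : 0 < |deriv (negLog g) R| := abs_pos.2 (hg.deriv_neg R hRm).ne
  set a := |deriv (negLog f) R|
  set b := |deriv (negLog g) R|
  have he : ∀ c, 0 < c → ∀ x, |x| ≤ R → Real.exp (-(c / 2 * (R - |x|))) ≤ 1 := by
    intro c hc x hx
    rw [Real.exp_le_one_iff]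
    have : 0 ≤ c / 2 * (R - |x|) := mul_nonneg (by positivity) (by linarith)
    linarith
  have hmem : ∀ p ∈ ccBall (diag3 f g) 0 R, |p 0| ≤ R ∧
      |p 1| ≤ 2 * (f R / a) * Real.exp (-(a / 2 * (R - |p 0|))) ∧
      |p 2| ≤ 2 * (g R / b) * Real.exp (-(b / 2 * (R - |p 0|))) := by
    intro p hp
    have h1 := hcf (image_ccBall_diag3_subset_fst f g R ⟨p, hp, rfl⟩)
    have h2 := hcg (image_ccBall_diag3_subset_snd f g R ⟨p, hp, rfl⟩)
    exact ⟨h1.1, h1.2, h2.2⟩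
  rw [mul_min_of_nonneg _ _ (by norm_num : (0 : ℝ) ≤ 64)]
  rcases min_choice (64 * (f R * g R / (a ^ 2 * b))) (64 * (f R * g R / (a * b ^ 2)))
    with hmin | hmin <;> rw [hmin]
  -- The decay is kept in the second coordinate and bounded by `1` in the third; the other case
  -- exchanges the roles.
  · refine (measure_mono (t := {p : Fin 3 → ℝ | |p 0| ≤ R ∧
      |p 1| ≤ (fun x => 2 * (f R / a) * Real.exp (-(a / 2 * (R - |x|)))) (p 0) ∧
      |p 2| ≤ (fun _ => 2 * (g R / b)) (p 0)}) ?_).trans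
      ((volume_setOf_abs_le_le (h := fun x => 2 * (f R / a) * Real.exp (-(a / 2 * (R - |x|))))
        (k := fun _ => 2 * (g R / b)) hR.le (by fun_prop) (by fun_prop)
        (fun x => by positivity) (fun x => by positivity)).trans (ENNReal.ofReal_le_ofReal ?_))
    · intro p hp
      obtain ⟨h0, h1, h2⟩ := hmem p hp
      exact ⟨h0, h1, h2.trans (mul_le_of_le_one_right (by positivity) (he b hb _ h0))⟩
    -- Each side of the rectangle carries a factor `4`, giving `16`; the integral is at most `2 / (a
    -- / 2) = 4 / a`, whence `64`.
    · calc ∫ x in (-R)..R, 2 * (2 * (f R / a) * Real.exp (-(a / 2 * (R - |x|)))) *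
            (2 * (2 * (g R / b)))
          = 16 * (f R / a) * (g R / b) * ∫ x in (-R)..R, Real.exp (-(a / 2 * (R - |x|))) := by
            rw [← intervalIntegral.integral_const_mul]
            congr 1; ext x; ring
        _ ≤ 16 * (f R / a) * (g R / b) * (2 / (a / 2)) := by
            have := integral_exp_neg_mul_sub_abs_le (half_pos ha) hR.le
            gcongr
        _ = 64 * (f R * g R / (a ^ 2 * b)) := by field_simp; norm_num
  · refine (measure_mono (t := {p : Fin 3 → ℝ | |p 0| ≤ R ∧
      |p 1| ≤ (fun _ => 2 * (f R / a)) (p 0) ∧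
      |p 2| ≤ (fun x => 2 * (g R / b) * Real.exp (-(b / 2 * (R - |x|)))) (p 0)}) ?_).trans
      ((volume_setOf_abs_le_le (h := fun _ => 2 * (f R / a))
        (k := fun x => 2 * (g R / b) * Real.exp (-(b / 2 * (R - |x|)))) hR.le (by fun_prop) (by fun_prop)
        (fun x => by positivity) (fun x => by positivity)).trans (ENNReal.ofReal_le_ofReal ?_))
    · intro p hp
      obtain ⟨h0, h1, h2⟩ := hmem p hp
      exact ⟨h0, h1.trans (mul_le_of_le_one_right (by positivity) (he a ha _ h0)), h2⟩
    · calc ∫ x in (-R)..R, 2 * (2 * (f R / a)) *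
            (2 * (2 * (g R / b) * Real.exp (-(b / 2 * (R - |x|)))))
          = 16 * (f R / a) * (g R / b) * ∫ x in (-R)..R, Real.exp (-(b / 2 * (R - |x|))) := by
            rw [← intervalIntegral.integral_const_mul]
            congr 1; ext x; ring
        _ ≤ 16 * (f R / a) * (g R / b) * (2 / (b / 2)) := by
            have := integral_exp_neg_mul_sub_abs_le (half_pos hb) hR.le
            gcongr
        _ = 64 * (f R * g R / (a * b ^ 2)) := by field_simp; norm_num

end CarnotCaratheodory

theorem mainTheorem1 :
    ∃ C : ℝ, 0 < C ∧ ∀ (f g : ℝ → ℝ) (R₀ : ℝ),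
      CarnotCaratheodory.IsDegenerateProfile f R₀ →
      CarnotCaratheodory.IsDegenerateProfile g R₀ →
      ∀ R : ℝ, 0 < R → R < R₀ →
        (fun p : Fin 3 → ℝ => ![p 0, p 1]) ''
            CarnotCaratheodory.ccBall (CarnotCaratheodory.diag3 f g) 0 R ⊆
          CarnotCaratheodory.ccBall (CarnotCaratheodory.diag2 f) 0 R ∧
        (fun p : Fin 3 → ℝ => ![p 0, p 2]) ''
            CarnotCaratheodory.ccBall (CarnotCaratheodory.diag3 f g) 0 R ⊆
          CarnotCaratheodory.ccBall (CarnotCaratheodory.diag2 g) 0 R ∧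
        volume (CarnotCaratheodory.ccBall (CarnotCaratheodory.diag3 f g) 0 R) ≤
          ENNReal.ofReal (C * min
            (f R * g R / (|deriv (CarnotCaratheodory.negLog f) R| ^ 2 *
              |deriv (CarnotCaratheodory.negLog g) R|))
            (f R * g R / (|deriv (CarnotCaratheodory.negLog f) R| *
              |deriv (CarnotCaratheodory.negLog g) R| ^ 2))) :=
  ⟨64, by norm_num, fun f g _ hf hg R hR hRR₀ =>
    ⟨CarnotCaratheodory.image_ccBall_diag3_subset_fst f g R,
      CarnotCaratheodory.image_ccBall_diag3_subset_snd f g R,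
      CarnotCaratheodory.volume_ccBall_diag3_le hf hg hR hRR₀⟩⟩
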